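/- Let $\mathbb{K}\in\{\mathbb{R},\mathbb{C}\}$, $n\in\mathbb{N}_0$ and $a<b$. Consider a hyperbolic boundary control system $(n,P_1,P_0,\mathcal{H},\widetilde W_B,\widetilde W_C)$ on $[a,b]$, $$\partial_t x=P_1\,\partial_\xi(\mathcal{H}x)+P_0\,\mathcal{H}x,\qquad u=\widetilde W_B\begin{bmatrix}(\mathcal{H}x)(b)\\(\mathcal{H}x)(a)\end{bmatrix},\qquad y=\widetilde W_C\begin{bmatrix}(\mathcal{H}x)(b)\\(\mathcal{H}x)(a)\end{bmatrix},$$ such that 1. $P_1\in\mathbb{K}^{n\times n}$ is invertible and self-adjoint; 2. $P_0\in L^\infty([a,b],\mathbb{K}^{n\times n})$; 3. $\mathcal{H}\in L^\infty([a,b],\mathbb{K}^{n\times n})$, $\mathcal{H}(\xi)$ is self-adjoint for a.e. $\xi$, and there are $c,C>0$ with $cI_n\le\mathcal{H}(\xi)\le CI_n$ for a.e. $\xi\in[a,b]$; 4. $\widetilde W_B\in\mathbb{K}^{n\times 2n}$ and $\begin{bmatrix}\widetilde W_B\\ \widetilde W_C\end{bmatrix}\in\mathbb{K}^{2n\times 2n}$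 have full rank; 5. the operator $A=P_1\frac{\partial}{\partial\xi}\mathcal{H}+P_0\mathcal{H}$ with domain $$\mathrm{D}(A)=\left\{x_0\in L^2([a,b],\mathbb{K}^n)\;:\;\mathcal{H}x_0\in H^1([a,b],\mathbb{K}^n),\ \widetilde W_B\begin{bmatrix}(\mathcal{H}x_0)(b)\\(\mathcal{H}x_0)(a)\end{bmatrix}=0\right\}$$ is the infinitesimal generator of a $C_0$-semigroup on $L^2([a,b],\mathbb{K}^n)$. Assume moreover that there are $0\le m\le n$ and $S,\mathcal{H}^D\in C^1([a,b],\mathbb{K}^{n\times n})$, with $S$ pointwise invertible and $\mathcal{H}^D$ pointwise diagonal and positive definite, such that $P_1\mathcal{H}=S^{-1}P_1^D\mathcal{H}^DS$ a.e. on $[a,b]$, where $P_1^D=\begin{pmatrix}I_m&0\\0&-I_{n-m}\end{pmatrix}$. Under the state transformation $\widetilde x=Sx$ the system becomes the diagonalised system $(n,P_1^D,P_0^D,\mathcal{H}^D,\widetilde W_B^D,\widetilde W_C^D)$, where $P_0^D=S\left[(S^{-1})'+P_0P_1^{-1}S^{-1}\right]P_1^D$ and $$\widetilde W_\bullet^D=\widetilde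 W_\bullet\begin{bmatrix}P_1^{-1}S^{-1}(b)P_1^D&0\\0&P_1^{-1}S^{-1}(a)P_1^D\end{bmatrix},\qquad \bullet\in\{B,C\}.$$ Let $E_+^D$ and $E_-^D$ be the spans of the eigenvectors of $P_1^D$ to positive and to negative eigenvalues, respectively, $\iota_\pm$ the embedding of $E_\pm^D$ into $\mathbb{K}^n$, $P_\pm^D=\iota_\pm\iota_\pm^*$ the orthogonal projection onto $E^D_\pm$, and $Q_\pm^D=\iota_\pm\left(\iota_\pm^*(\pm P_1^D)\iota_\pm\right)^{1/2}\iota_\pm^*$ (so $P_+^D=Q_+^D=\begin{pmatrix}I_m&0\\0&0\end{pmatrix}$ and $P_-^D=Q_-^D=\begin{pmatrix}0&0\\0&I_{n-m}\end{pmatrix}$). Then the $n\times n$ matrix $\widetilde W_B^D\begin{bmatrix}P_+^D\\P_-^D\end{bmatrix}$ is invertible, and there exist matrices $K,M\in\mathbb{K}^{n\times n}$ with $K$ invertible such that $$\widetilde W_B^D=K\begin{pmatrix}Q_+^D-MQ_-^D&\;Q_-^D-MQ_+^D\end{pmatrix}.$$ -/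

import Mathlib

open Set Filter Topology MeasureTheory
open scoped ComplexOrder Matrix

noncomputable section

/-! ### Strongly continuous semigroups and their generators -/

/-- `T t`, `t ≥ 0`, is a `C₀`-semigroup of bounded operators on `X` (values at negative times are
irrelevant). Only the topology of `X` enters, so the notion is the same for equivalent norms. -/
structure IsC0Semigroup {𝕜 X : Type*} [RCLike 𝕜] [AddCommGroup X] [Module 𝕜 X]
    [TopologicalSpace X] (T : ℝ → X →L[𝕜] X) : Prop where
  map_zero : T 0 = ContinuousLinearMap.id 𝕜 X
  map_add : ∀ s t : ℝ, 0 ≤ s → 0 ≤ t → T (s + t) = (T s).comp (T t)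
  tendsto_zero : ∀ x : X, Tendsto (fun t => T t x) (𝓝[>] 0) (𝓝 x)

/-- An unbounded operator is given by its graph: `A x y` means `x ∈ D(A)` and `A x = y`.
It generates a `C₀`-semigroup if, for some `C₀`-semigroup `T`, it is precisely the operator
`x ↦ lim_{t ↓ 0} (T t x - x) / t`, defined for those `x` for which the limit exists. -/
def GeneratesC0Semigroup (𝕜 : Type*) {X : Type*} [RCLike 𝕜] [AddCommGroup X] [Module 𝕜 X]
    [TopologicalSpace X] (A : X → X → Prop) : Prop :=
  ∃ T : ℝ → X →L[𝕜] X, IsC0Semigroup T ∧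
    ∀ x y : X, A x y ↔
      Tendsto (fun t : ℝ => ((t⁻¹ : ℝ) : 𝕜) • (T t x - x)) (𝓝[>] 0) (𝓝 y)

/-! ### Hyperbolic boundary control systems -/

/-- The data `(n, P₁, P₀, 𝓗, W_B, W_C)` of a linear hyperbolic boundary control system on `[a, b]`.
The columns of `W_B`, `W_C` are indexed by `Fin n ⊕ Fin n`: the left block acts on the value at
`b`, the right block on the value at `a`. -/
structure HBCS (𝕜 : Type*) (n : ℕ) where
  a : ℝ
  b : ℝ
  P₁ : Matrix (Fin n) (Fin n) 𝕜
  P₀ : ℝ → Matrix (Fin n) (Fin n) 𝕜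
  H : ℝ → Matrix (Fin n) (Fin n) 𝕜
  WB : Matrix (Fin n) (Fin n ⊕ Fin n) 𝕜
  WC : Matrix (Fin n) (Fin n ⊕ Fin n) 𝕜

/-- `v ∈ H¹([a, b], 𝕜ⁿ)` with (weak) derivative `w`: `w ∈ L²` and `v` is the (absolutely)
continuous primitive of `w`. -/
def HasH1Deriv {𝕜 : Type*} [RCLike 𝕜] {n : ℕ} (a b : ℝ) (v w : ℝ → Fin n → 𝕜) : Prop :=
  MemLp w 2 (volume.restrict (Icc a b)) ∧ ∀ ξ ∈ Icc a b, v ξ = v a + ∫ t in a..ξ, w t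

namespace HBCS

variable {𝕜 : Type*} [RCLike 𝕜] {n : ℕ}

/-- The state space `L²([a, b], 𝕜ⁿ)`. (The inner product weighted by a bounded, coercive `𝓗` gives
an equivalent norm, hence the same topology.) -/
abbrev StateSpace (sys : HBCS 𝕜 n) : Type _ :=
  Lp (EuclideanSpace 𝕜 (Fin n)) 2 (volume.restrict (Icc sys.a sys.b))

/-- The graph of `A = P₁ ∂_ξ 𝓗 + P₀ 𝓗` with domain
`{x ∈ X | 𝓗 x ∈ H¹, W_B [(𝓗 x)(b); (𝓗 x)(a)] = 0}`. Here `v` is the continuous representative of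
`𝓗 x` and `w` its derivative. -/
def operator (sys : HBCS 𝕜 n) (x y : sys.StateSpace) : Prop :=
  ∃ v w : ℝ → Fin n → 𝕜,
    HasH1Deriv sys.a sys.b v w ∧
    (∀ᵐ ξ ∂(volume.restrict (Icc sys.a sys.b)), v ξ = sys.H ξ *ᵥ (x ξ).ofLp) ∧
    sys.WB *ᵥ Sum.elim (v sys.b) (v sys.a) = 0 ∧
    (∀ᵐ ξ ∂(volume.restrict (Icc sys.a sys.b)),
      (y ξ).ofLp = sys.P₁ *ᵥ w ξ + sys.P₀ ξ *ᵥ v ξ)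

/-- The standing assumptions on a hyperbolic boundary control system. -/
structure StandingAssumption (sys : HBCS 𝕜 n) : Prop where
  a_lt_b : sys.a < sys.b
  P₁_isUnit : IsUnit sys.P₁
  P₁_isHermitian : sys.P₁.IsHermitian
  P₀_memLp : ∀ i j, MemLp (fun ξ => sys.P₀ ξ i j) ⊤ (volume.restrict (Icc sys.a sys.b))
  H_memLp : ∀ i j, MemLp (fun ξ => sys.H ξ i j) ⊤ (volume.restrict (Icc sys.a sys.b))
  H_isHermitian : ∀ᵐ ξ ∂(volume.restrict (Icc sys.a sys.b)), (sys.H ξ).IsHermitian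
  H_bounds : ∃ c C : ℝ, 0 < c ∧ 0 < C ∧ ∀ᵐ ξ ∂(volume.restrict (Icc sys.a sys.b)),
    (sys.H ξ - (c : 𝕜) • (1 : Matrix (Fin n) (Fin n) 𝕜)).PosSemidef ∧
    ((C : 𝕜) • (1 : Matrix (Fin n) (Fin n) 𝕜) - sys.H ξ).PosSemidef
  WB_rank : sys.WB.rank = n
  WBC_rank : (Matrix.fromRows sys.WB sys.WC).rank = 2 * n
  generates : GeneratesC0Semigroup 𝕜 sys.operator

end HBCS

/-! ### Spectral splitting of a Hermitian matrix -/

section Splitting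

variable {𝕜 : Type*} [RCLike 𝕜] {n : ℕ}

/-- `E₊`: the span of the eigenvectors of `P` to positive eigenvalues. -/
def posSpace (P : Matrix (Fin n) (Fin n) 𝕜) : Submodule 𝕜 (EuclideanSpace 𝕜 (Fin n)) :=
  Submodule.span 𝕜 {v | ∃ r : ℝ, 0 < r ∧ Matrix.toEuclideanLin P v = (r : 𝕜) • v}

/-- `E₋`: the span of the eigenvectors of `P` to negative eigenvalues. -/
def negSpace (P : Matrix (Fin n) (Fin n) 𝕜) : Submodule 𝕜 (EuclideanSpace 𝕜 (Fin n)) :=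
  Submodule.span 𝕜 {v | ∃ r : ℝ, r < 0 ∧ Matrix.toEuclideanLin P v = (r : 𝕜) • v}

/-- The matrix of the orthogonal projection onto a subspace `E` of `𝕜ⁿ`. -/
def projMatrix (E : Submodule 𝕜 (EuclideanSpace 𝕜 (Fin n))) : Matrix (Fin n) (Fin n) 𝕜 :=
  (Matrix.toEuclideanCLM (n := Fin n) (𝕜 := 𝕜)).symm E.starProjection

/-- `P₊ = ι₊ ι₊*`. -/
def projPos (P : Matrix (Fin n) (Fin n) 𝕜) : Matrix (Fin n) (Fin n) 𝕜 := projMatrix (posSpace P)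

/-- `P₋ = ι₋ ι₋*`. -/
def projNeg (P : Matrix (Fin n) (Fin n) 𝕜) : Matrix (Fin n) (Fin n) 𝕜 := projMatrix (negSpace P)

/-- `Q₊ = ι₊ (ι₊* P ι₊)^{1/2} ι₊*`, i.e. the square root of the positive semidefinite matrix
`P₊ P P₊ = ι₊ (ι₊* P ι₊) ι₊*`, which acts as `ι₊* P ι₊` on `E₊` and vanishes on its complement. -/
def rootPos (P : Matrix (Fin n) (Fin n) 𝕜) : Matrix (Fin n) (Fin n) 𝕜 :=
  cfc Real.sqrt (projPos P * P * projPos P)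

/-- `Q₋ = ι₋ (ι₋* (-P) ι₋)^{1/2} ι₋*`, i.e. the square root of `P₋ (-P) P₋`. -/
def rootNeg (P : Matrix (Fin n) (Fin n) 𝕜) : Matrix (Fin n) (Fin n) 𝕜 :=
  cfc Real.sqrt (projNeg P * (-P) * projNeg P)

end Splitting

/-! ### Diagonalisation -/

/-- `P₁ᴰ = diag(1, …, 1, -1, …, -1)` with `m` entries `1`. -/
def signMatrix (𝕜 : Type*) [RCLike 𝕜] (n m : ℕ) : Matrix (Fin n) (Fin n) 𝕜 :=
  Matrix.diagonal fun i => if (i : ℕ) < m then 1 else -1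

namespace HBCS

variable {𝕜 : Type*} [RCLike 𝕜] {n : ℕ}

/-- The `C¹`-diagonalisation assumption: `S, 𝓗ᴰ ∈ C¹([a, b], 𝕜ⁿˣⁿ)`, `S` pointwise invertible,
`𝓗ᴰ` diagonal and positive, and `P₁ 𝓗 = S⁻¹ P₁ᴰ 𝓗ᴰ S` (almost everywhere, as `𝓗 ∈ L^∞`). -/
structure IsC1Diagonalisation (sys : HBCS 𝕜 n) (m : ℕ) (S HD : ℝ → Matrix (Fin n) (Fin n) 𝕜) :
    Prop where
  m_le : m ≤ n
  S_contDiff : ∀ i j, ContDiffOn ℝ 1 (fun ξ => S ξ i j) (Icc sys.a sys.b)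
  HD_contDiff : ∀ i j, ContDiffOn ℝ 1 (fun ξ => HD ξ i j) (Icc sys.a sys.b)
  S_isUnit : ∀ ξ ∈ Icc sys.a sys.b, IsUnit (S ξ)
  HD_isDiag : ∀ ξ ∈ Icc sys.a sys.b, (HD ξ).IsDiag
  HD_posDef : ∀ ξ ∈ Icc sys.a sys.b, (HD ξ).PosDef
  diag_eq : ∀ᵐ ξ ∂(volume.restrict (Icc sys.a sys.b)),
    sys.P₁ * sys.H ξ = (S ξ)⁻¹ * signMatrix 𝕜 n m * HD ξ * S ξ

/-- The block matrix `diag(P₁⁻¹ S(b)⁻¹ P₁ᴰ, P₁⁻¹ S(a)⁻¹ P₁ᴰ)` transforming boundary values. -/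
def boundaryTransform (sys : HBCS 𝕜 n) (m : ℕ) (S : ℝ → Matrix (Fin n) (Fin n) 𝕜) :
    Matrix (Fin n ⊕ Fin n) (Fin n ⊕ Fin n) 𝕜 :=
  Matrix.fromBlocks (sys.P₁⁻¹ * (S sys.b)⁻¹ * signMatrix 𝕜 n m) 0
    0 (sys.P₁⁻¹ * (S sys.a)⁻¹ * signMatrix 𝕜 n m)

/-- The diagonalised system `(n, P₁ᴰ, P₀ᴰ, 𝓗ᴰ, W_Bᴰ, W_Cᴰ)`, obtained by the state transformation
`x ↦ S x`, where `P₀ᴰ = S ((S⁻¹)' + P₀ P₁⁻¹ S⁻¹) P₁ᴰ`. -/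
def diagonalise (sys : HBCS 𝕜 n) (m : ℕ) (S HD : ℝ → Matrix (Fin n) (Fin n) 𝕜) : HBCS 𝕜 n where
  a := sys.a
  b := sys.b
  P₁ := signMatrix 𝕜 n m
  P₀ := fun ξ => S ξ *
    (Matrix.of (fun i j => derivWithin (fun η => (S η)⁻¹ i j) (Icc sys.a sys.b) ξ)
      + sys.P₀ ξ * sys.P₁⁻¹ * (S ξ)⁻¹) * signMatrix 𝕜 n m
  H := HD
  WB := sys.WB * sys.boundaryTransform m S
  WC := sys.WC * sys.boundaryTransform m S

end HBCS

end

/-! Suppose `W_Bᴰ [P₊ᴰ k; P₋ᴰ k] = 0` for some `k ≠ 0`. For `r > 0` let the `i`-th component of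
`w` be a wave which enters with value `kᵢ` at the end of `[a, b]` where the `i`-th characteristic
enters, grows at rate `r` along that characteristic and vanishes at the other end. The boundary
values of `w` are then `P₊ᴰ k` at `b` and `P₋ᴰ k` at `a`, so the state `x` with `𝓗ᴰ S x = w` lies in
`D(A)`. The transformation to diagonal form and `P₀` contribute only bounded terms to `r x - A x`,
whence `‖r x - A x‖ ≤ C ‖x‖` with `C` independent of `r`. For large `r` this contradicts the
estimate `r ‖x‖ ≤ C' ‖r x - A x‖` valid for the generator of a `C₀`-semigroup.

The factorisation of `W_Bᴰ` is then algebra: `[[P₊, P₋], [P₋, P₊]]` is its own inverse, so one takes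
`K = W_Bᴰ [P₊; P₋]` and `M = -K⁻¹ W_Bᴰ [P₋; P₊]`. -/

section SpectralSplitting

variable {𝕜 : Type*} [RCLike 𝕜] {n : ℕ}

lemma projMatrix_span_eq {D : Matrix (Fin n) (Fin n) 𝕜} (hD : D.IsHermitian)
    {s : Set (EuclideanSpace 𝕜 (Fin n))} (range_subset : ∀ v, Matrix.toEuclideanLin D v ∈ s)
    (fixes : ∀ w ∈ s, Matrix.toEuclideanLin D w = w) :
    projMatrix (Submodule.span 𝕜 s) = D := by
  rw [projMatrix, StarAlgEquiv.symm_apply_eq]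
  ext1 v
  refine Submodule.eq_starProjection_of_mem_of_inner_eq_zero
    (Submodule.subset_span (range_subset v)) fun w hw => ?_
  have fixes_span : Matrix.toEuclideanLin D w = w :=
    LinearMap.eqOn_span (g := LinearMap.id) fixes hw
  have symmetric := Matrix.isSymmetric_toEuclideanLin_iff.mpr hD v w
  rw [fixes_span] at symmetric
  rw [inner_sub_left, sub_eq_zero]
  exact symmetric.symm

lemma negSpace_eq_posSpace_neg (P : Matrix (Fin n) (Fin n) 𝕜) : negSpace P = posSpace (-P) := by
  refine congrArg (Submodule.span 𝕜) (Set.ext fun v => (Equiv.neg ℝ).exists_congr fun r => ?_)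
  simp [neg_eq_iff_eq_neg]

lemma projNeg_eq_projPos_neg (P : Matrix (Fin n) (Fin n) 𝕜) : projNeg P = projPos (-P) :=
  congrArg projMatrix (negSpace_eq_posSpace_neg P)

lemma rootNeg_eq_rootPos_neg (P : Matrix (Fin n) (Fin n) 𝕜) : rootNeg P = rootPos (-P) := by
  rw [rootNeg, rootPos, projNeg_eq_projPos_neg]

lemma cfc_sqrt_of_isStarProjection {D : Matrix (Fin n) (Fin n) 𝕜} (hD : IsStarProjection D) :
    cfc Real.sqrt D = D := by
  have := hD.isSelfAdjoint
  refine (cfc_congr (g := id) fun x hx => ?_).trans (cfc_id ℝ D)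
  rcases hD.isIdempotentElem.spectrum_subset ℝ hx with rfl | rfl <;> simp

section Involution

variable {P : Matrix (Fin n) (Fin n) 𝕜} (hP : P.IsHermitian) (hPP : P * P = 1)
include hP hPP

lemma projPos_of_mul_self_eq_one : projPos P = (2⁻¹ : 𝕜) • (1 + P) := by
  have involutive (v) : Matrix.toEuclideanLin P (Matrix.toEuclideanLin P v) = v := by
    rw [← LinearMap.comp_apply, ← Matrix.toLpLin_mul_same, hPP, Matrix.toLpLin_one,
      LinearMap.id_apply]
  have apply_eq (v) : Matrix.toEuclideanLin ((2⁻¹ : 𝕜) • (1 + P)) v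
      = (2⁻¹ : 𝕜) • (v + Matrix.toEuclideanLin P v) := by
    simp
  refine projMatrix_span_eq (by simp [Matrix.IsHermitian, hP.eq])
    (fun v => ⟨1, one_pos, ?_⟩) ?_
  · rw [apply_eq, map_smul, map_add, involutive, add_comm, RCLike.ofReal_one, one_smul]
  · rintro w ⟨r, hr, hw⟩
    have annihilated : ((r + 1 : ℝ) : 𝕜) • (Matrix.toEuclideanLin P w - w) = 0 := by
      have r_sq_smul : (r : 𝕜) • (r : 𝕜) • w = w := by rw [← hw, ← map_smul, ← hw, involutive]
      rw [hw, smul_sub, smul_smul, RCLike.ofReal_add, RCLike.ofReal_one, add_mul, add_smul,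
        add_smul, ← smul_smul, r_sq_smul, one_mul, one_smul, add_comm w, sub_self]
    have r_add_one_ne_zero : ((r + 1 : ℝ) : 𝕜) ≠ 0 :=
      RCLike.ofReal_ne_zero.mpr (by positivity)
    rw [apply_eq, sub_eq_zero.mp ((smul_eq_zero.mp annihilated).resolve_left r_add_one_ne_zero)]
    module

lemma projNeg_of_mul_self_eq_one : projNeg P = 1 - projPos P := by
  rw [projNeg_eq_projPos_neg, projPos_of_mul_self_eq_one hP.neg (by rw [neg_mul_neg, hPP]),
    projPos_of_mul_self_eq_one hP hPP]
  module

lemma isStarProjection_projPos : IsStarProjection (projPos P) := by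
  rw [projPos_of_mul_self_eq_one hP hPP]
  refine ⟨?_, by simp [isSelfAdjoint_iff, Matrix.star_eq_conjTranspose, hP.eq]⟩
  rw [IsIdempotentElem, smul_mul_smul_comm, mul_add, add_mul, add_mul, hPP, one_mul, one_mul,
    mul_one]
  module

lemma rootPos_of_mul_self_eq_one : rootPos P = projPos P := by
  have isStarProjection := isStarProjection_projPos hP hPP
  have projPos_mul : projPos P * P = projPos P := by
    rw [projPos_of_mul_self_eq_one hP hPP, smul_mul_assoc, add_mul, one_mul, hPP, add_comm]
  rw [rootPos, projPos_mul, isStarProjection.isIdempotentElem.eq,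
    cfc_sqrt_of_isStarProjection isStarProjection]

lemma rootNeg_of_mul_self_eq_one : rootNeg P = projNeg P := by
  rw [rootNeg_eq_rootPos_neg, rootPos_of_mul_self_eq_one hP.neg (by rw [neg_mul_neg, hPP]),
    projNeg_eq_projPos_neg]

end Involution

lemma isHermitian_signMatrix (m : ℕ) : (signMatrix 𝕜 n m).IsHermitian :=
  Matrix.isHermitian_diagonal_of_self_adjoint _ (funext fun i => by
    simp only [Pi.star_apply]; split_ifs <;> simp)

lemma signMatrix_mul_self (m : ℕ) : signMatrix 𝕜 n m * signMatrix 𝕜 n m = 1 := by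
  rw [signMatrix, Matrix.diagonal_mul_diagonal, ← Matrix.diagonal_one]
  congr 1 with i
  split_ifs <;> simp

end SpectralSplitting

lemma exists_eq_mul_fromCols_of_isUnit {R ι : Type*} [CommRing R] [Fintype ι] [DecidableEq ι]
    {W : Matrix ι (ι ⊕ ι) R} {P : Matrix ι ι R} (hP : IsIdempotentElem P)
    (hK : IsUnit (W * Matrix.fromRows P (1 - P))) :
    ∃ K M : Matrix ι ι R, IsUnit K ∧
      W = K * Matrix.fromCols (P - M * (1 - P)) (1 - P - M * P) := by
  have involution : Matrix.fromBlocks P (1 - P) (1 - P) P * Matrix.fromBlocks P (1 - P) (1 - P) P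
      = 1 := by
    rw [Matrix.fromBlocks_multiply, ← Matrix.fromBlocks_one, hP.one_sub.eq, hP.eq,
      hP.mul_one_sub_self, hP.one_sub_mul_self]
    simp
  set K := W * Matrix.fromRows P (1 - P)
  set L := W * Matrix.fromRows (1 - P) P
  obtain ⟨hK'⟩ := hK.nonempty_invertible
  refine ⟨K, -(K⁻¹ * L), hK, ?_⟩
  calc W = W * Matrix.fromCols (Matrix.fromRows P (1 - P)) (Matrix.fromRows (1 - P) P)
        * Matrix.fromBlocks P (1 - P) (1 - P) P := by
        rw [Matrix.fromCols_fromRows_eq_fromBlocks, Matrix.mul_assoc, involution, Matrix.mul_one]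
    _ = Matrix.fromCols K L * Matrix.fromBlocks P (1 - P) (1 - P) P := by
        rw [Matrix.mul_fromCols]
    _ = Matrix.fromCols (K * P + L * (1 - P)) (K * (1 - P) + L * P) :=
        Matrix.fromCols_mul_fromBlocks ..
    _ = _ := by
        simp [Matrix.mul_fromCols, Matrix.mul_add, ← Matrix.mul_assoc]

section C0Semigroup

variable {𝕜 X : Type*} [RCLike 𝕜] [NormedAddCommGroup X] [NormedSpace 𝕜 X]

namespace IsC0Semigroup

variable {T : ℝ → X →L[𝕜] X}

lemma tendsto_nhdsGE (hT : IsC0Semigroup T) (x : X) :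
    Tendsto (fun t => T t x) (𝓝[≥] 0) (𝓝 x) := by
  rw [← Ioi_insert, nhdsWithin_insert, tendsto_sup]
  refine ⟨tendsto_pure_left.mpr fun s hs => ?_, hT.tendsto_zero x⟩
  rw [hT.map_zero]
  exact mem_of_mem_nhds hs

lemma apply_add (hT : IsC0Semigroup T) {s t : ℝ} (hs : 0 ≤ s) (ht : 0 ≤ t) (x : X) :
    T (s + t) x = T s (T t x) := by
  rw [hT.map_add s t hs ht, ContinuousLinearMap.comp_apply]

lemma exists_norm_le [CompleteSpace X] (hT : IsC0Semigroup T) :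
    ∃ δ M : ℝ, 0 < δ ∧ 0 < M ∧ ∀ t ∈ Icc 0 δ, ‖T t‖ ≤ M := by
  by_contra! unbounded
  have exists_large (k : ℕ) : ∃ t ∈ Icc (0 : ℝ) (1 / ((k : ℝ) + 1)), (k : ℝ) + 1 < ‖T t‖ :=
    unbounded _ _ (by positivity) (by positivity)
  choose t ht lt_norm using exists_large
  have t_tendsto : Tendsto t atTop (𝓝[≥] 0) := tendsto_nhdsWithin_iff.mpr
    ⟨squeeze_zero (fun k => (ht k).1) (fun k => (ht k).2) tendsto_one_div_add_atTop_nhds_zero_nat,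
      Eventually.of_forall fun k => (ht k).1⟩
  obtain ⟨C, norm_le⟩ := banach_steinhaus (g := fun k => T (t k)) fun x => by
    obtain ⟨C, hC⟩ := ((hT.tendsto_nhdsGE x).comp t_tendsto).norm.bddAbove_range
    exact ⟨C, fun k => hC ⟨k, rfl⟩⟩
  obtain ⟨k, hk⟩ := exists_nat_ge C
  linarith [norm_le k, lt_norm k]

lemma norm_apply_sub_apply_le (hT : IsC0Semigroup T) {δ M : ℝ}
    (hM : ∀ t ∈ Icc 0 δ, ‖T t‖ ≤ M) (x : X) {s t : ℝ} (hs : s ∈ Icc 0 δ) (ht : t ∈ Icc 0 δ) :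
    ‖T s x - T t x‖ ≤ M * ‖T |s - t| x - x‖ := by
  wlog hst : s ≤ t generalizing s t
  · rw [norm_sub_rev, abs_sub_comm]
    exact this ht hs (le_of_not_ge hst)
  have apply_t : T t x = T s (T |s - t| x) := by
    rw [abs_sub_comm, abs_of_nonneg (sub_nonneg.mpr hst), ← hT.apply_add hs.1 (sub_nonneg.mpr hst),
      add_sub_cancel]
  rw [apply_t, ← map_sub, norm_sub_rev (T |s - t| x)]
  exact (T s).le_of_opNorm_le (hM s hs) _

lemma continuousOn_apply (hT : IsC0Semigroup T) {δ M : ℝ}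
    (hM : ∀ t ∈ Icc 0 δ, ‖T t‖ ≤ M) (x : X) : ContinuousOn (fun t => T t x) (Icc 0 δ) := by
  intro t ht
  have abs_sub_tendsto : Tendsto (fun s => |s - t|) (𝓝[Icc 0 δ] t) (𝓝[≥] 0) := by
    refine tendsto_nhdsWithin_iff.mpr ⟨?_, Eventually.of_forall fun s => abs_nonneg (s - t)⟩
    have : Continuous fun s : ℝ => |s - t| := by fun_prop
    simpa using (this.tendsto t).mono_left nhdsWithin_le_nhds
  have bound_tendsto : Tendsto (fun s => M * ‖T |s - t| x - x‖) (𝓝[Icc 0 δ] t) (𝓝 0) := by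
    simpa using ((((hT.tendsto_nhdsGE x).comp abs_sub_tendsto).sub_const x).norm).const_mul M
  rw [ContinuousWithinAt, tendsto_iff_norm_sub_tendsto_zero]
  refine squeeze_zero' (Eventually.of_forall fun s => norm_nonneg _) ?_ bound_tendsto
  filter_upwards [self_mem_nhdsWithin] with s hs using hT.norm_apply_sub_apply_le hM x hs ht

lemma hasDerivWithinAt_apply [NormedSpace ℝ X] [IsScalarTower ℝ 𝕜 X] (hT : IsC0Semigroup T)
    {x y : X} (hxy : Tendsto (fun t : ℝ => ((t⁻¹ : ℝ) : 𝕜) • (T t x - x)) (𝓝[>] 0) (𝓝 y))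
    {t : ℝ} (ht : 0 ≤ t) : HasDerivWithinAt (fun t => T t x) (T t y) (Ici t) t := by
  rw [← hasDerivWithinAt_Ioi_iff_Ici, hasDerivWithinAt_iff_tendsto_slope' self_notMem_Ioi]
  have sub_tendsto : Tendsto (fun s => s - t) (𝓝[>] t) (𝓝[>] 0) := by
    refine tendsto_nhdsWithin_iff.mpr ⟨?_, ?_⟩
    · have : Continuous fun s : ℝ => s - t := by fun_prop
      simpa using (this.tendsto t).mono_left nhdsWithin_le_nhds
    · filter_upwards [self_mem_nhdsWithin] with s hs using sub_pos.mpr (mem_Ioi.mp hs)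
  refine (((T t).continuous.tendsto y).comp (hxy.comp sub_tendsto)).congr' ?_
  filter_upwards [self_mem_nhdsWithin] with s hs
  rw [Function.comp_apply, Function.comp_apply, map_smul, map_sub,
    ← hT.apply_add ht (sub_pos.mpr (mem_Ioi.mp hs)).le, add_sub_cancel, slope_def_module,
    RCLike.real_smul_eq_coe_smul (K := 𝕜)]

/-- For `x ∈ D(A)`, the derivative of `e^{-rt} T(t) x` is `-e^{-rt} T(t) (r - A) x`. -/
lemma norm_exp_smul_apply_sub_le (hT : IsC0Semigroup T) {δ M : ℝ}
    (hM : ∀ t ∈ Icc 0 δ, ‖T t‖ ≤ M) {x y : X}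
    (hxy : Tendsto (fun t : ℝ => ((t⁻¹ : ℝ) : 𝕜) • (T t x - x)) (𝓝[>] 0) (𝓝 y))
    {r t : ℝ} (hr : 0 ≤ r) (ht : t ∈ Icc 0 δ) :
    ‖((Real.exp (-(r * t)) : ℝ) : 𝕜) • T t x - x‖ ≤ M * ‖(r : 𝕜) • x - y‖ * t := by
  let _ : NormedSpace ℝ X := NormedSpace.restrictScalars ℝ 𝕜 X
  have hasDeriv (s : ℝ) (hs : s ∈ Ico 0 δ) :
      HasDerivWithinAt (fun s => Real.exp (-(r * s)) • T s x)
        (-(Real.exp (-(r * s)) • T s ((r : 𝕜) • x - y))) (Ici s) s := by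
    have exp_hasDeriv : HasDerivAt (fun s => Real.exp (-(r * s))) (Real.exp (-(r * s)) * -r) s := by
      simpa using (((hasDerivAt_id s).const_mul r).neg).exp
    refine (exp_hasDeriv.hasDerivWithinAt.smul (hT.hasDerivWithinAt_apply hxy hs.1)).congr_deriv ?_
    rw [map_sub, map_smul, ← RCLike.real_smul_eq_coe_smul (K := 𝕜)]
    module
  have continuous : ContinuousOn (fun s => Real.exp (-(r * s)) • T s x) (Icc 0 δ) :=
    ContinuousOn.smul (f := fun s => Real.exp (-(r * s))) (by fun_prop)
      (hT.continuousOn_apply hM x)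
  have deriv_le (s : ℝ) (hs : s ∈ Ico 0 δ) :
      ‖-(Real.exp (-(r * s)) • T s ((r : 𝕜) • x - y))‖ ≤ M * ‖(r : 𝕜) • x - y‖ := by
    rw [norm_neg, norm_smul, Real.norm_of_nonneg (Real.exp_nonneg _)]
    refine (mul_le_of_le_one_left (norm_nonneg _) ?_).trans
      ((T s).le_of_opNorm_le (hM s (Ico_subset_Icc_self hs)) _)
    exact Real.exp_le_one_iff.mpr (neg_nonpos.mpr (mul_nonneg hr hs.1))
  simpa [hT.map_zero] using norm_image_sub_le_of_norm_deriv_right_le_segment continuous hasDeriv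
    deriv_le t ht

end IsC0Semigroup

lemma GeneratesC0Semigroup.exists_mul_norm_le [CompleteSpace X] {A : X → X → Prop}
    (hA : GeneratesC0Semigroup 𝕜 A) :
    ∃ C r₀ : ℝ, 0 < C ∧ ∀ r, r₀ ≤ r → ∀ x y, A x y → r * ‖x‖ ≤ C * ‖(r : 𝕜) • x - y‖ := by
  obtain ⟨T, hT, A_iff⟩ := hA
  obtain ⟨δ, M, δ_pos, M_pos, hM⟩ := hT.exists_norm_le
  obtain ⟨ρ, exp_small, ρ_pos⟩ : ∃ ρ, M * Real.exp (-ρ) ≤ 1 / 2 ∧ 0 < ρ := by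
    have tendsto_zero : Tendsto (fun ρ => M * Real.exp (-ρ)) atTop (𝓝 0) := by
      simpa using Real.tendsto_exp_neg_atTop_nhds_zero.const_mul M
    exact ((tendsto_zero.eventually_le_const (by norm_num)).and (eventually_gt_atTop 0)).exists
  refine ⟨2 * M * ρ, ρ / δ, by positivity, fun r hr x y hxy => ?_⟩
  have r_pos : 0 < r := (div_pos ρ_pos δ_pos).trans_le hr
  have time_mem : ρ / r ∈ Icc 0 δ := ⟨by positivity, (div_le_comm₀ δ_pos r_pos).mp hr⟩
  have orbit_near_x := hT.norm_exp_smul_apply_sub_le hM ((A_iff x y).mp hxy) r_pos.le time_mem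
  rw [mul_div_cancel₀ ρ r_pos.ne'] at orbit_near_x
  have orbit_small : ‖((Real.exp (-ρ) : ℝ) : 𝕜) • T (ρ / r) x‖ ≤ ‖x‖ / 2 :=
    calc ‖((Real.exp (-ρ) : ℝ) : 𝕜) • T (ρ / r) x‖ = Real.exp (-ρ) * ‖T (ρ / r) x‖ := by
          rw [norm_smul, RCLike.norm_of_nonneg (Real.exp_nonneg _)]
      _ ≤ Real.exp (-ρ) * (M * ‖x‖) := by
          gcongr
          exact (T _).le_of_opNorm_le (hM _ time_mem) x
      _ = M * Real.exp (-ρ) * ‖x‖ := by ring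
      _ ≤ 1 / 2 * ‖x‖ := by gcongr
      _ = ‖x‖ / 2 := by ring
  have norm_x_le : ‖x‖ ≤ 2 * (M * ‖(r : 𝕜) • x - y‖ * (ρ / r)) := by
    linarith [norm_le_norm_add_norm_sub (((Real.exp (-ρ) : ℝ) : 𝕜) • T (ρ / r) x) x]
  calc r * ‖x‖ ≤ r * (2 * (M * ‖(r : 𝕜) • x - y‖ * (ρ / r))) := by gcongr
    _ = 2 * M * ρ * ‖(r : 𝕜) • x - y‖ := by field_simp

lemma GeneratesC0Semigroup.bddAbove_approximate_eigenvalues [CompleteSpace X] {A : X → X → Prop}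
    (hA : GeneratesC0Semigroup 𝕜 A) (C : ℝ) :
    BddAbove {r : ℝ | ∃ x y, A x y ∧ x ≠ 0 ∧ ‖(r : 𝕜) • x - y‖ ≤ C * ‖x‖} := by
  obtain ⟨C', r₀, C'_pos, resolvent_bound⟩ := hA.exists_mul_norm_le
  refine ⟨max r₀ (C' * C), ?_⟩
  rintro r ⟨x, y, hxy, x_ne_zero, approx⟩
  refine le_max_iff.mpr (or_iff_not_imp_left.mpr fun hr => ?_)
  refine le_of_mul_le_mul_right ?_ (norm_pos_iff.mpr x_ne_zero)
  calc r * ‖x‖ ≤ C' * ‖(r : 𝕜) • x - y‖ := resolvent_bound r (le_of_not_ge hr) x y hxy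
    _ ≤ C' * (C * ‖x‖) := by gcongr
    _ = C' * C * ‖x‖ := by ring

end C0Semigroup

section Lp

lemma memLp_Icc_of_continuousOn {E : Type*} [NormedAddCommGroup E] {a b : ℝ} {f : ℝ → E}
    (hf : ContinuousOn f (Icc a b)) (p : ENNReal) : MemLp f p (volume.restrict (Icc a b)) := by
  obtain ⟨C, hC⟩ := isCompact_Icc.exists_bound_of_continuousOn hf
  exact MemLp.of_bound (hf.aestronglyMeasurable_of_isCompact isCompact_Icc measurableSet_Icc) C
    ((ae_restrict_iff' measurableSet_Icc).mpr (.of_forall hC))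

lemma eLpNorm_Icc_ne_zero_of_continuousOn {E : Type*} [NormedAddCommGroup E] {a b ξ : ℝ} {f : ℝ → E}
    {p : ENNReal} (hab : a < b) (hf : ContinuousOn f (Icc a b)) (hp : p ≠ 0) (hξ : ξ ∈ Icc a b)
    (hfξ : f ξ ≠ 0) : eLpNorm f p (volume.restrict (Icc a b)) ≠ 0 := by
  rw [Ne, eLpNorm_eq_zero_iff
    (hf.aestronglyMeasurable_of_isCompact isCompact_Icc measurableSet_Icc) hp]
  exact fun ae_zero =>
    hfξ (Measure.eqOn_Icc_of_ae_eq volume hab.ne ae_zero hf continuousOn_const hξ)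

lemma eLpNorm_smul_const {α E : Type*} {mα : MeasurableSpace α} {μ : Measure α}
    [NormedAddCommGroup E] [NormedSpace ℝ E] {p : ENNReal} (f : α → ℝ) (k : E) :
    eLpNorm (fun x => f x • k) p μ = ‖k‖ₑ * eLpNorm f p μ := by
  rw [← enorm_norm k, ← eLpNorm_const_smul]
  refine eLpNorm_congr_norm_ae (.of_forall fun x => ?_)
  rw [norm_smul, Pi.smul_apply, norm_smul, norm_norm, mul_comm]

lemma eLpNorm_le_sum_mul_eLpNorm {α ι E F : Type*} [Fintype ι] {mα : MeasurableSpace α}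
    {μ : Measure α} [NormedAddCommGroup E] [NormedAddCommGroup F] {p : ENNReal}
    {f : α → ι → E} {g : α → ι → F} {C : ι → NNReal} (hp : 1 ≤ p)
    (hf : ∀ i, AEStronglyMeasurable (fun x => f x i) μ)
    (hfg : ∀ i, eLpNorm (fun x => f x i) p μ ≤ C i * eLpNorm (fun x => g x i) p μ) :
    eLpNorm f p μ ≤ (∑ i, C i : NNReal) * eLpNorm g p μ :=
  calc eLpNorm f p μ ≤ eLpNorm (∑ i, fun x => ‖f x i‖) p μ := by
        refine eLpNorm_mono_real fun x => ?_
        rw [Finset.sum_apply]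
        exact (pi_norm_le_iff_of_nonneg (Finset.sum_nonneg fun i _ => norm_nonneg _)).mpr fun i =>
          Finset.single_le_sum (f := fun i => ‖f x i‖) (fun i _ => norm_nonneg _)
            (Finset.mem_univ i)
    _ ≤ ∑ i, eLpNorm (fun x => ‖f x i‖) p μ := eLpNorm_sum_le (fun i _ => (hf i).norm) hp
    _ = ∑ i, eLpNorm (fun x => f x i) p μ := Finset.sum_congr rfl fun i _ => eLpNorm_norm _
    _ ≤ ∑ i, C i * eLpNorm g p μ := Finset.sum_le_sum fun i _ => (hfg i).trans <| by
        gcongr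
        exact eLpNorm_mono fun x => norm_le_pi_norm (g x) i
    _ = (∑ i, C i : NNReal) * eLpNorm g p μ := by
        rw [← Finset.sum_mul, ENNReal.ofNNReal_finsetSum]

end Lp

noncomputable section TravelTime

variable {a b : ℝ} {d s : ℝ → ℝ} {inlet outlet : ℝ}

/-- `s ξ` is the time a wave of signed slowness `d` needs to travel from `ξ` to the end `outlet` of
`[a, b]`, having entered at the end `inlet`. -/
structure IsTravelTime (a b : ℝ) (d s : ℝ → ℝ) (inlet outlet : ℝ) : Prop where
  hasDerivWithinAt : ∀ ξ ∈ Icc a b, HasDerivWithinAt s (d ξ) (Icc a b) ξ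
  nonneg : ∀ ξ ∈ Icc a b, 0 ≤ s ξ
  outlet_eq_zero : s outlet = 0
  inlet_mem : inlet ∈ Icc a b
  inlet_pos : 0 < s inlet

lemma exists_isTravelTime_of_pos (hab : a < b) (hd : ContinuousOn d (Icc a b))
    (d_pos : ∀ ξ ∈ Icc a b, 0 < d ξ) : ∃ s, IsTravelTime a b d s b a := by
  refine ⟨fun ξ => ∫ t in a..ξ, d t, fun ξ hξ => ?_, fun ξ hξ => ?_, intervalIntegral.integral_same,
    right_mem_Icc.mpr hab.le, ?_⟩
  · have : Fact (ξ ∈ Icc a b) := ⟨hξ⟩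
    exact intervalIntegral.integral_hasDerivWithinAt_right
      ((hd.mono (Icc_subset_Icc_right hξ.2)).intervalIntegrable_of_Icc hξ.1)
      (hd.stronglyMeasurableAtFilter_nhdsWithin measurableSet_Icc ξ) (hd ξ hξ)
  · exact intervalIntegral.integral_nonneg hξ.1 fun t ht =>
      (d_pos t (Icc_subset_Icc_right hξ.2 ht)).le
  · exact intervalIntegral.intervalIntegral_pos_of_pos_on (hd.intervalIntegrable_of_Icc hab.le)
      (fun ξ hξ => d_pos ξ (Ioo_subset_Icc_self hξ)) hab

lemma exists_isTravelTime_of_neg (hab : a < b) (hd : ContinuousOn d (Icc a b))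
    (d_neg : ∀ ξ ∈ Icc a b, d ξ < 0) : ∃ s, IsTravelTime a b d s a b := by
  refine ⟨fun ξ => -∫ t in ξ..b, d t, fun ξ hξ => ?_, fun ξ hξ => ?_, by simp,
    left_mem_Icc.mpr hab.le, ?_⟩
  · have : Fact (ξ ∈ Icc a b) := ⟨hξ⟩
    exact (intervalIntegral.integral_hasDerivWithinAt_left
      ((hd.mono (Icc_subset_Icc_left hξ.1)).intervalIntegrable_of_Icc hξ.2)
      (hd.stronglyMeasurableAtFilter_nhdsWithin measurableSet_Icc ξ) (hd ξ hξ)).fun_neg.congr_deriv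
      (neg_neg _)
  · rw [← intervalIntegral.integral_neg]
    exact intervalIntegral.integral_nonneg hξ.2 fun t ht =>
      (neg_pos.mpr (d_neg t (Icc_subset_Icc_left hξ.1 ht))).le
  · rw [← intervalIntegral.integral_neg]
    exact intervalIntegral.intervalIntegral_pos_of_pos_on (hd.neg.intervalIntegrable_of_Icc hab.le)
      (fun ξ hξ => neg_pos.mpr (d_neg ξ (Ioo_subset_Icc_self hξ))) hab

/-- The profile of a wave growing at rate `r` that enters at the inlet with value `1`. The function
`e^{rs}` solves `φ' = r d φ`; subtracting `1` makes it vanish at the outlet, at the price of a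
defect that stays small compared with the wave itself. -/
def waveProfile (s : ℝ → ℝ) (inlet r ξ : ℝ) : ℝ :=
  (Real.exp (r * s ξ) - 1) / (Real.exp (r * s inlet) - 1)

namespace IsTravelTime

variable (hs : IsTravelTime a b d s inlet outlet)
include hs

lemma exp_sub_one_pos {r : ℝ} (hr : 0 < r) : 0 < Real.exp (r * s inlet) - 1 :=
  sub_pos.mpr (Real.one_lt_exp_iff.mpr (mul_pos hr hs.inlet_pos))

lemma waveProfile_inlet {r : ℝ} (hr : 0 < r) : waveProfile s inlet r inlet = 1 :=
  div_self (hs.exp_sub_one_pos hr).ne'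

lemma waveProfile_outlet (r : ℝ) : waveProfile s inlet r outlet = 0 := by
  simp [waveProfile, hs.outlet_eq_zero]

lemma hasDerivWithinAt_waveProfile (r : ℝ) {ξ : ℝ} (hξ : ξ ∈ Icc a b) :
    HasDerivWithinAt (waveProfile s inlet r)
      (r * d ξ * waveProfile s inlet r ξ + r / (Real.exp (r * s inlet) - 1) * d ξ)
      (Icc a b) ξ := by
  refine (((((hs.hasDerivWithinAt ξ hξ).const_mul r).exp).sub_const 1).div_const _).congr_deriv ?_
  rw [waveProfile]
  ring

lemma continuousOn : ContinuousOn s (Icc a b) := fun ξ hξ =>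
  (hs.hasDerivWithinAt ξ hξ).continuousWithinAt

lemma eLpNorm_ne_zero (hab : a < b) {p : ENNReal} (hp : p ≠ 0) :
    eLpNorm s p (volume.restrict (Icc a b)) ≠ 0 :=
  eLpNorm_Icc_ne_zero_of_continuousOn hab hs.continuousOn hp hs.inlet_mem hs.inlet_pos.ne'

lemma mul_le_waveProfile {r : ℝ} (hr : 0 < r) (ξ : ℝ) :
    r / (Real.exp (r * s inlet) - 1) * s ξ ≤ waveProfile s inlet r ξ := by
  rw [waveProfile, div_mul_eq_mul_div]
  exact div_le_div_of_nonneg_right (by linarith [Real.add_one_le_exp (r * s ξ)])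
    (hs.exp_sub_one_pos hr).le

lemma exists_eLpNorm_defect_le (hab : a < b) (hd : ContinuousOn d (Icc a b)) {p : ENNReal}
    (hp : p ≠ 0) : ∃ C : NNReal, ∀ r, 0 < r →
      eLpNorm (fun ξ => r / (Real.exp (r * s inlet) - 1) * d ξ) p (volume.restrict (Icc a b)) ≤
        C * eLpNorm (waveProfile s inlet r) p (volume.restrict (Icc a b)) := by
  set μ := volume.restrict (Icc a b)
  have d_memLp : MemLp d p μ := memLp_Icc_of_continuousOn hd p
  have s_memLp : MemLp s p μ := memLp_Icc_of_continuousOn hs.continuousOn p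
  have ratio_ne_top : eLpNorm d p μ / eLpNorm s p μ ≠ ⊤ :=
    ENNReal.div_ne_top d_memLp.2.ne (hs.eLpNorm_ne_zero hab hp)
  refine ⟨(eLpNorm d p μ / eLpNorm s p μ).toNNReal, fun r hr => ?_⟩
  set κ := r / (Real.exp (r * s inlet) - 1)
  have κ_nonneg : 0 ≤ κ := div_nonneg hr.le (hs.exp_sub_one_pos hr).le
  have profile_ge : eLpNorm (κ • s) p μ ≤ eLpNorm (waveProfile s inlet r) p μ := by
    refine eLpNorm_mono_ae ((ae_restrict_iff' measurableSet_Icc).mpr (.of_forall fun ξ hξ => ?_))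
    have := hs.mul_le_waveProfile hr ξ
    exact abs_le_abs_of_nonneg (mul_nonneg κ_nonneg (hs.nonneg ξ hξ)) this
  calc eLpNorm (κ • d) p μ = ‖κ‖ₑ * eLpNorm d p μ := eLpNorm_const_smul ..
    _ = eLpNorm d p μ / eLpNorm s p μ * (‖κ‖ₑ * eLpNorm s p μ) := by
        rw [mul_left_comm, ENNReal.div_mul_cancel (hs.eLpNorm_ne_zero hab hp) s_memLp.2.ne]
    _ = eLpNorm d p μ / eLpNorm s p μ * eLpNorm (κ • s) p μ := by rw [eLpNorm_const_smul]
    _ ≤ eLpNorm d p μ / eLpNorm s p μ * eLpNorm (waveProfile s inlet r) p μ := by gcongr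
    _ = _ := by rw [ENNReal.coe_toNNReal ratio_ne_top]

end IsTravelTime

lemma exists_travelling_waves {ι E : Type*} [Fintype ι] [NormedAddCommGroup E] [NormedSpace ℝ E]
    {a b : ℝ} {d s : ι → ℝ → ℝ} {inlet outlet : ι → ℝ} {p : ENNReal} (hab : a < b) (hp : 1 ≤ p)
    (hd : ∀ i, ContinuousOn (d i) (Icc a b))
    (hs : ∀ i, IsTravelTime a b (d i) (s i) (inlet i) (outlet i)) (k : ι → E) :
    ∃ C : NNReal, ∀ r : ℝ, 0 < r → ∃ w w' : ℝ → ι → E,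
      (∀ ξ ∈ Icc a b, HasDerivWithinAt w (w' ξ) (Icc a b) ξ) ∧ ContinuousOn w' (Icc a b) ∧
      (∀ i, w (inlet i) i = k i) ∧ (∀ i, w (outlet i) i = 0) ∧
      eLpNorm (fun ξ i => r • d i ξ • w ξ i - w' ξ i) p (volume.restrict (Icc a b)) ≤
        C * eLpNorm w p (volume.restrict (Icc a b)) := by
  choose C hC using fun i => (hs i).exists_eLpNorm_defect_le hab (hd i) (one_pos.trans_le hp).ne'
  refine ⟨∑ i, C i, fun r hr => ?_⟩
  set φ : ι → ℝ → ℝ := fun i => waveProfile (s i) (inlet i) r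
  set defect : ι → ℝ → ℝ := fun i ξ => r / (Real.exp (r * s i (inlet i)) - 1) * d i ξ
  have φ_hasDeriv (i : ι) {ξ : ℝ} (hξ : ξ ∈ Icc a b) :
      HasDerivWithinAt (φ i) (r * d i ξ * φ i ξ + defect i ξ) (Icc a b) ξ :=
    (hs i).hasDerivWithinAt_waveProfile r hξ
  have φ_continuousOn (i : ι) : ContinuousOn (φ i) (Icc a b) := fun ξ hξ =>
    (φ_hasDeriv i hξ).continuousWithinAt
  have defect_continuousOn (i : ι) : ContinuousOn (defect i) (Icc a b) :=
    continuousOn_const.mul (hd i)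
  have defect_eq (i : ι) (ξ : ℝ) : r • d i ξ • φ i ξ • k i
      - (r * d i ξ * φ i ξ + defect i ξ) • k i = -(defect i ξ • k i) := by
    module
  refine ⟨fun ξ i => φ i ξ • k i, fun ξ i => (r * d i ξ * φ i ξ + defect i ξ) • k i,
    fun ξ hξ => hasDerivWithinAt_pi.mpr fun i => (φ_hasDeriv i hξ).smul_const _, by fun_prop,
    fun i => (congrArg (· • k i) ((hs i).waveProfile_inlet hr)).trans (one_smul ℝ _),
    fun i => (congrArg (· • k i) ((hs i).waveProfile_outlet r)).trans (zero_smul ℝ _), ?_⟩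
  simp only [defect_eq]
  refine eLpNorm_le_sum_mul_eLpNorm hp (fun i => ?_) fun i => ?_
  · exact (memLp_Icc_of_continuousOn ((defect_continuousOn i).smul continuousOn_const).neg p).1
  · calc eLpNorm (fun ξ => -(defect i ξ • k i)) p (volume.restrict (Icc a b))
        = ‖k i‖ₑ * eLpNorm (defect i) p (volume.restrict (Icc a b)) :=
          (eLpNorm_neg ..).trans (eLpNorm_smul_const ..)
      _ ≤ ‖k i‖ₑ * (C i * eLpNorm (φ i) p (volume.restrict (Icc a b))) := by
          gcongr
          exact hC i r hr
      _ = C i * eLpNorm (fun ξ => φ i ξ • k i) p (volume.restrict (Icc a b)) := by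
          rw [eLpNorm_smul_const, mul_left_comm]

end TravelTime

section MatrixFunctions

variable {𝕜 ι κ : Type*} [RCLike 𝕜]

section Calculus

variable {E : Type*} [NormedAddCommGroup E] [NormedSpace ℝ E] {s : Set E}

lemma contDiffOn_mul_apply [Fintype ι] {ι' : Type*} {k : WithTop ℕ∞} {A : E → Matrix κ ι 𝕜}
    {B : E → Matrix ι ι' 𝕜} (hA : ∀ i j, ContDiffOn ℝ k (fun x => A x i j) s)
    (hB : ∀ i j, ContDiffOn ℝ k (fun x => B x i j) s) (i : κ) (j : ι') :
    ContDiffOn ℝ k (fun x => (A x * B x) i j) s :=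
  ContDiffOn.sum fun l _ => (hA i l).mul (hB l j)

lemma contDiffOn_det [Fintype ι] [DecidableEq ι] {k : WithTop ℕ∞} {A : E → Matrix ι ι 𝕜}
    (hA : ∀ i j, ContDiffOn ℝ k (fun x => A x i j) s) : ContDiffOn ℝ k (fun x => (A x).det) s := by
  simp only [Matrix.det_apply']
  exact ContDiffOn.sum fun σ _ => contDiffOn_const.mul (contDiffOn_prod fun i _ => hA _ _)

lemma contDiffOn_inv_apply [Fintype ι] [DecidableEq ι] {k : WithTop ℕ∞} {A : E → Matrix ι ι 𝕜}
    (hA : ∀ i j, ContDiffOn ℝ k (fun x => A x i j) s) (isUnit : ∀ x ∈ s, IsUnit (A x)) (i j : ι) :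
    ContDiffOn ℝ k (fun x => (A x)⁻¹ i j) s := by
  simp only [Matrix.inv_def, Ring.inverse_eq_inv', Matrix.smul_apply, smul_eq_mul,
    Matrix.adjugate_apply]
  refine ((contDiffOn_det hA).inv fun x hx =>
    ((Matrix.isUnit_iff_isUnit_det _).mp (isUnit x hx)).ne_zero).mul
      (contDiffOn_det fun i' j' => ?_)
  by_cases hi : i' = j
  · simp only [hi, Matrix.updateRow_self]
    exact contDiffOn_const
  · simpa only [Matrix.updateRow_ne hi] using hA i' j'

lemma continuousOn_of_contDiffOn_apply {k : WithTop ℕ∞} {A : E → Matrix ι ι 𝕜}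
    (hA : ∀ i j, ContDiffOn ℝ k (fun x => A x i j) s) : ContinuousOn A s :=
  continuousOn_pi.mpr fun i => continuousOn_pi.mpr fun j => (hA i j).continuousOn

lemma continuousOn_mulVec [Fintype ι] {X : Type*} [TopologicalSpace X] {s : Set X}
    {A : X → Matrix κ ι 𝕜} {v : X → ι → 𝕜} (hA : ContinuousOn A s) (hv : ContinuousOn v s) :
    ContinuousOn (fun x => A x *ᵥ v x) s :=
  (continuous_fst.matrix_mulVec continuous_snd).comp_continuousOn (hA.prodMk hv)

lemma hasDerivWithinAt_mulVec [Fintype ι] [Finite κ] {s : Set ℝ} {ξ : ℝ} {A : ℝ → Matrix κ ι 𝕜}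
    {A' : Matrix κ ι 𝕜} {v : ℝ → ι → 𝕜} {v' : ι → 𝕜}
    (hA : ∀ i j, HasDerivWithinAt (fun η => A η i j) (A' i j) s ξ)
    (hv : HasDerivWithinAt v v' s ξ) :
    HasDerivWithinAt (fun η => A η *ᵥ v η) (A' *ᵥ v ξ + A ξ *ᵥ v') s ξ := by
  have := Fintype.ofFinite κ
  refine hasDerivWithinAt_pi.mpr fun i => ?_
  refine (HasDerivWithinAt.fun_sum fun j _ =>
    (hA i j).mul (hasDerivWithinAt_pi.mp hv j)).congr_deriv ?_
  rw [Finset.sum_add_distrib]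
  rfl

lemma exists_hasDerivWithinAt_of_contDiffOn_apply {a b : ℝ} (hab : a < b) {A : ℝ → Matrix κ ι 𝕜}
    (hA : ∀ i j, ContDiffOn ℝ 1 (fun ξ => A ξ i j) (Icc a b)) :
    ∃ A' : ℝ → Matrix κ ι 𝕜, ContinuousOn A' (Icc a b) ∧ ∀ ξ ∈ Icc a b, ∀ i j,
      HasDerivWithinAt (fun η => A η i j) (A' ξ i j) (Icc a b) ξ :=
  ⟨fun ξ => Matrix.of fun i j => derivWithin (fun η => A η i j) (Icc a b) ξ,
    continuousOn_pi.mpr fun i => continuousOn_pi.mpr fun j =>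
      (hA i j).continuousOn_derivWithin (uniqueDiffOn_Icc hab) le_rfl,
    fun ξ hξ i j => ((hA i j).differentiableOn one_ne_zero ξ hξ).hasDerivWithinAt⟩

end Calculus

section Lp

variable {α : Type*} {mα : MeasurableSpace α} {μ : Measure α} {p : ENNReal}
  {A : α → Matrix κ ι 𝕜}

lemma memLp_Icc_apply_of_continuousOn {a b : ℝ} {A : ℝ → Matrix κ ι 𝕜}
    (hA : ContinuousOn A (Icc a b)) (p : ENNReal) (i : κ) (j : ι) :
    MemLp (fun ξ => A ξ i j) p (volume.restrict (Icc a b)) :=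
  memLp_Icc_of_continuousOn (continuousOn_pi.mp (continuousOn_pi.mp hA i) j) p

variable [Fintype ι]

lemma memLp_mulVec [Fintype κ] (hA : ∀ i j, MemLp (fun x => A x i j) ⊤ μ) {v : α → ι → 𝕜}
    (hv : MemLp v p μ) : MemLp (fun x => A x *ᵥ v x) p μ :=
  MemLp.of_eval fun i => memLp_finsetSum Finset.univ fun j _ => (hv.eval j).mul (hA i j)

lemma exists_eLpNorm_mulVec_le [Fintype κ] (hA : ∀ i j, MemLp (fun x => A x i j) ⊤ μ) :
    ∃ C : NNReal, ∀ v : α → ι → 𝕜, eLpNorm (fun x => A x *ᵥ v x) p μ ≤ C * eLpNorm v p μ := by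
  have entry_bounded (i : κ) (j : ι) : ∀ᵐ x ∂μ,
      ‖A x i j‖₊ ≤ (eLpNorm (fun x => A x i j) ⊤ μ).toNNReal := by
    filter_upwards [enorm_ae_le_eLpNormEssSup (fun x => A x i j) μ] with x hx
    rw [← eLpNorm_exponent_top] at hx
    exact ENNReal.le_toNNReal_of_coe_le hx (hA i j).2.ne
  refine ⟨∑ i, ∑ j, (eLpNorm (fun x => A x i j) ⊤ μ).toNNReal, fun v =>
    eLpNorm_le_nnreal_smul_eLpNorm_of_ae_le_mul ?_ p⟩
  filter_upwards [ae_all_iff.mpr fun i => ae_all_iff.mpr (entry_bounded i)] with x entry_le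
  refine pi_nnnorm_le_iff.mpr fun i => ?_
  calc ‖(A x *ᵥ v x) i‖₊ ≤ ∑ j, ‖A x i j‖₊ * ‖v x j‖₊ := by
        simp only [← nnnorm_mul]
        exact nnnorm_sum_le Finset.univ fun j => A x i j * v x j
    _ ≤ ∑ j, (eLpNorm (fun x => A x i j) ⊤ μ).toNNReal * ‖v x‖₊ := by
        gcongr with j
        exacts [entry_le i j, nnnorm_le_pi_nnnorm (v x) j]
    _ ≤ (∑ i, ∑ j, (eLpNorm (fun x => A x i j) ⊤ μ).toNNReal) * ‖v x‖₊ := by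
        rw [← Finset.sum_mul]
        gcongr
        exact Finset.single_le_sum (f := fun i => ∑ j, (eLpNorm (fun x => A x i j) ⊤ μ).toNNReal)
          (fun _ _ => zero_le) (Finset.mem_univ i)

lemma exists_ofLp_ae_eq {f : α → ι → 𝕜} (q : ENNReal) [Fact (1 ≤ q)] (hf : MemLp f p μ) :
    ∃ g : Lp (PiLp q fun _ : ι => 𝕜) p μ, (fun x => (g x).ofLp) =ᵐ[μ] f :=
  ⟨MemLp.toLp (fun x => WithLp.toLp q (f x)) (.of_eval_piLp hf.eval),
    (MemLp.coeFn_toLp _).fun_comp WithLp.ofLp⟩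

lemma norm_le_mul_norm_of_eLpNorm_ofLp_le {q : ENNReal} [Fact (1 ≤ p)] [Fact (1 ≤ q)]
    {f g : Lp (PiLp q fun _ : ι => 𝕜) p μ} {C : NNReal}
    (hfg : eLpNorm (fun x => (f x).ofLp) p μ ≤ C * eLpNorm (fun x => (g x).ofLp) p μ) :
    ‖f‖ ≤ (Fintype.card ι : NNReal) ^ (1 / q).toReal * C * ‖g‖ := by
  set c : NNReal := (Fintype.card ι : NNReal) ^ (1 / q).toReal
  have ofLp_le (z : PiLp q fun _ : ι => 𝕜) : ‖z.ofLp‖₊ ≤ 1 * ‖z‖₊ :=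
    LipschitzWith.nnorm_le_mul (PiLp.lipschitzWith_ofLp q fun _ : ι => 𝕜) rfl z
  have le_ofLp (z : PiLp q fun _ : ι => 𝕜) : ‖z‖₊ ≤ c * ‖z.ofLp‖₊ :=
    (PiLp.antilipschitzWith_ofLp q fun _ : ι => 𝕜).le_mul_nnnorm rfl z
  suffices (‖f‖₊ : ENNReal) ≤ (c * C : NNReal) * ‖g‖₊ from mod_cast this
  calc (‖f‖₊ : ENNReal) = eLpNorm f p μ := Lp.enorm_def f
    _ ≤ c * eLpNorm (fun x => (f x).ofLp) p μ :=
        eLpNorm_le_nnreal_smul_eLpNorm_of_ae_le_mul (.of_forall fun x => le_ofLp (f x)) p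
    _ ≤ c * (C * eLpNorm (fun x => (g x).ofLp) p μ) := by gcongr
    _ ≤ c * (C * ((1 : NNReal) * eLpNorm g p μ)) := by
        gcongr
        exact eLpNorm_le_nnreal_smul_eLpNorm_of_ae_le_mul (.of_forall fun x => ofLp_le (g x)) p
    _ = (c * C : NNReal) * ‖g‖₊ := by
        rw [ENNReal.coe_one, one_mul, ENNReal.coe_mul, mul_assoc, ← Lp.enorm_def, enorm_eq_nnnorm]

end Lp

lemma HasH1Deriv.of_hasDerivWithinAt {n : ℕ} {a b : ℝ} {v w : ℝ → Fin n → 𝕜}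
    (hv : ∀ ξ ∈ Icc a b, HasDerivWithinAt v (w ξ) (Icc a b) ξ)
    (hw : MemLp w 2 (volume.restrict (Icc a b))) : HasH1Deriv a b v w := by
  refine ⟨hw, fun ξ hξ => ?_⟩
  have hw_int : IntervalIntegrable w volume a ξ := by
    rw [intervalIntegrable_iff_integrableOn_Icc_of_le hξ.1]
    exact (hw.integrable one_le_two).mono_measure
      (Measure.restrict_mono (Icc_subset_Icc_right hξ.2) le_rfl)
  rw [intervalIntegral.integral_eq_sub_of_hasDerivAt_of_le hξ.1
    (fun η hη => ((hv η (Icc_subset_Icc_right hξ.2 hη)).continuousWithinAt).mono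
      (Icc_subset_Icc_right hξ.2))
    (fun η hη => (hv η ⟨hη.1.le, hη.2.le.trans hξ.2⟩).hasDerivAt
      (Icc_mem_nhds hη.1 (hη.2.trans_le hξ.2))) hw_int, add_sub_cancel]

end MatrixFunctions

noncomputable section

variable {𝕜 : Type*} [RCLike 𝕜] {n : ℕ}

/-- `±1 / 𝓗ᴰᵢᵢ`, the `i`-th diagonal entry of `(P₁ᴰ 𝓗ᴰ)⁻¹`: the reciprocal of the velocity of the
`i`-th characteristic. The real part only serves to make this diagonal entry a real number. -/
def slowness (m : ℕ) (HD : ℝ → Matrix (Fin n) (Fin n) 𝕜) (i : Fin n) (ξ : ℝ) : ℝ :=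
  (if (i : ℕ) < m then 1 else -1) / RCLike.re (HD ξ i i)

lemma re_diag_pos {ι : Type*} {D : Matrix ι ι 𝕜} (hD : D.PosDef) (i : ι) :
    0 < RCLike.re (D i i) :=
  (RCLike.pos_iff.mp hD.diag_pos).1

lemma signMatrix_mulVec_inv_mulVec {m : ℕ} {HD : ℝ → Matrix (Fin n) (Fin n) 𝕜} {ξ : ℝ}
    (isDiag : (HD ξ).IsDiag) (posDef : (HD ξ).PosDef) (v : Fin n → 𝕜) :
    signMatrix 𝕜 n m *ᵥ ((HD ξ)⁻¹ *ᵥ v) = fun i => slowness m HD i ξ • v i := by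
  set u := (HD ξ)⁻¹ *ᵥ v with hu
  have v_eq (i : Fin n) : v i = RCLike.re (HD ξ i i) • u i := by
    have diag_eq : (RCLike.re (HD ξ i i) : 𝕜) = HD ξ i i :=
      RCLike.conj_eq_iff_re.mp (posDef.isHermitian.apply i i)
    calc v i = (HD ξ *ᵥ u) i := by
          rw [hu, Matrix.mulVec_mulVec, Matrix.mul_nonsing_inv _
            ((Matrix.isUnit_iff_isUnit_det _).mp posDef.isUnit), Matrix.one_mulVec]
      _ = HD ξ i i * u i := by
          rw [← isDiag.diagonal_diag, Matrix.mulVec_diagonal, Matrix.diagonal_apply_eq]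
      _ = RCLike.re (HD ξ i i) • u i := by rw [RCLike.real_smul_eq_coe_mul, diag_eq]
  ext i
  have := (re_diag_pos posDef i).ne'
  rw [signMatrix, Matrix.mulVec_diagonal, v_eq, smul_smul, slowness, div_mul_cancel₀ _ this]
  split_ifs <;> simp

lemma projPos_signMatrix_mulVec (m : ℕ) (k : Fin n → 𝕜) :
    projPos (signMatrix 𝕜 n m) *ᵥ k = fun i : Fin n => if (i : ℕ) < m then k i else 0 := by
  rw [projPos_of_mul_self_eq_one (isHermitian_signMatrix m) (signMatrix_mul_self m), signMatrix,
    ← Matrix.diagonal_one, Matrix.diagonal_add, ← Matrix.diagonal_smul]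
  ext i
  rw [Matrix.mulVec_diagonal]
  split_ifs <;> norm_num [*]

lemma projNeg_signMatrix_mulVec (m : ℕ) (k : Fin n → 𝕜) :
    projNeg (signMatrix 𝕜 n m) *ᵥ k = fun i : Fin n => if (i : ℕ) < m then 0 else k i := by
  rw [projNeg_of_mul_self_eq_one (isHermitian_signMatrix m) (signMatrix_mul_self m),
    Matrix.sub_mulVec, projPos_signMatrix_mulVec, Matrix.one_mulVec]
  ext i
  simp only [Pi.sub_apply]
  split_ifs <;> simp

namespace HBCS

/-- The matrix expressing the effort `𝓗 x` of the original system by the effort `𝓗ᴰ S x` of the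
diagonalised one. Its values at `b` and `a` are the blocks of `boundaryTransform`. -/
def effortTransform (sys : HBCS 𝕜 n) (m : ℕ) (S : ℝ → Matrix (Fin n) (Fin n) 𝕜) (ξ : ℝ) :
    Matrix (Fin n) (Fin n) 𝕜 :=
  sys.P₁⁻¹ * (S ξ)⁻¹ * signMatrix 𝕜 n m

variable {sys : HBCS 𝕜 n} {m : ℕ} {S HD : ℝ → Matrix (Fin n) (Fin n) 𝕜}

lemma diagonalise_WB_mulVec (u v : Fin n → 𝕜) :
    (sys.diagonalise m S HD).WB *ᵥ Sum.elim u v =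
      sys.WB *ᵥ Sum.elim (sys.effortTransform m S sys.b *ᵥ u)
        (sys.effortTransform m S sys.a *ᵥ v) := by
  rw [diagonalise, ← Matrix.mulVec_mulVec, boundaryTransform, Matrix.fromBlocks_mulVec]
  simp only [Sum.elim_comp_inl, Sum.elim_comp_inr, Matrix.zero_mulVec, add_zero, zero_add,
    effortTransform]

lemma P₁_mul_effortTransform (hP₁ : IsUnit sys.P₁) (ξ : ℝ) :
    sys.P₁ * sys.effortTransform m S ξ = (S ξ)⁻¹ * signMatrix 𝕜 n m := by
  rw [effortTransform, Matrix.mul_assoc,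
    Matrix.mul_nonsing_inv_cancel_left _ _ ((Matrix.isUnit_iff_isUnit_det _).mp hP₁)]

namespace IsC1Diagonalisation

variable (hdiag : sys.IsC1Diagonalisation m S HD)
include hdiag

lemma continuousOn_slowness (i : Fin n) : ContinuousOn (slowness m HD i) (Icc sys.a sys.b) :=
  continuousOn_const.div
    (RCLike.continuous_re.comp_continuousOn (hdiag.HD_contDiff i i).continuousOn)
    fun ξ hξ => (re_diag_pos (hdiag.HD_posDef ξ hξ) i).ne'

lemma exists_isTravelTime (hab : sys.a < sys.b) (i : Fin n) :
    ∃ s, IsTravelTime sys.a sys.b (slowness m HD i) s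
      (if (i : ℕ) < m then sys.b else sys.a) (if (i : ℕ) < m then sys.a else sys.b) := by
  have re_pos (ξ : ℝ) (hξ : ξ ∈ Icc sys.a sys.b) := re_diag_pos (hdiag.HD_posDef ξ hξ) i
  have continuousOn := hdiag.continuousOn_slowness i
  split_ifs with hi
  · exact exists_isTravelTime_of_pos hab continuousOn fun ξ hξ => by
      simpa only [slowness, hi, if_true] using div_pos one_pos (re_pos ξ hξ)
  · exact exists_isTravelTime_of_neg hab continuousOn fun ξ hξ => by
      simpa only [slowness, hi, if_false] using div_neg_of_neg_of_pos neg_one_lt_zero (re_pos ξ hξ)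

lemma contDiffOn_effortTransform_apply (i j : Fin n) :
    ContDiffOn ℝ 1 (fun ξ => sys.effortTransform m S ξ i j) (Icc sys.a sys.b) := by
  refine contDiffOn_mul_apply (B := fun _ => signMatrix 𝕜 n m) ?_ (fun _ _ => contDiffOn_const) i j
  exact contDiffOn_mul_apply (A := fun _ => sys.P₁⁻¹) (fun _ _ => contDiffOn_const)
    (contDiffOn_inv_apply hdiag.S_contDiff hdiag.S_isUnit)

lemma contDiffOn_HD_mul_S_apply (i j : Fin n) :
    ContDiffOn ℝ 1 (fun ξ => (HD ξ * S ξ) i j) (Icc sys.a sys.b) :=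
  contDiffOn_mul_apply hdiag.HD_contDiff hdiag.S_contDiff i j

lemma isUnit_HD_mul_S {ξ : ℝ} (hξ : ξ ∈ Icc sys.a sys.b) : IsUnit (HD ξ * S ξ) :=
  (hdiag.HD_posDef ξ hξ).isUnit.mul (hdiag.S_isUnit ξ hξ)

lemma H_mul_inv_eq_effortTransform (hP₁ : IsUnit sys.P₁) :
    ∀ᵐ ξ ∂volume.restrict (Icc sys.a sys.b),
      sys.H ξ * (HD ξ * S ξ)⁻¹ = sys.effortTransform m S ξ := by
  filter_upwards [hdiag.diag_eq, ae_restrict_mem measurableSet_Icc] with ξ diag_eq hξ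
  have det_isUnit := (Matrix.isUnit_iff_isUnit_det _).mp (hdiag.isUnit_HD_mul_S hξ)
  have P₁_det_isUnit := (Matrix.isUnit_iff_isUnit_det _).mp hP₁
  calc sys.H ξ * (HD ξ * S ξ)⁻¹ = sys.P₁⁻¹ * (sys.P₁ * sys.H ξ) * (HD ξ * S ξ)⁻¹ := by
        rw [Matrix.nonsing_inv_mul_cancel_left _ _ P₁_det_isUnit]
    _ = sys.effortTransform m S ξ * (HD ξ * S ξ) * (HD ξ * S ξ)⁻¹ := by
        simp only [diag_eq, effortTransform, Matrix.mul_assoc]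
    _ = sys.effortTransform m S ξ := Matrix.mul_nonsing_inv_cancel_right _ _ det_isUnit

lemma smul_inv_mulVec_sub_eq (hP₁ : IsUnit sys.P₁) {ξ : ℝ} (hξ : ξ ∈ Icc sys.a sys.b) (r : ℝ)
    (G' : Matrix (Fin n) (Fin n) 𝕜) (u u' : Fin n → 𝕜) :
    r • (HD ξ * S ξ)⁻¹ *ᵥ u - sys.P₁ *ᵥ (G' *ᵥ u + sys.effortTransform m S ξ *ᵥ u') =
      (sys.P₁ * sys.effortTransform m S ξ) *ᵥ (fun i => r • slowness m HD i ξ • u i - u' i)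
        - (sys.P₁ * G') *ᵥ u := by
  have split : (fun i => r • slowness m HD i ξ • u i - u' i)
      = r • signMatrix 𝕜 n m *ᵥ ((HD ξ)⁻¹ *ᵥ u) - u' := by
    rw [signMatrix_mulVec_inv_mulVec (hdiag.HD_isDiag ξ hξ) (hdiag.HD_posDef ξ hξ)]
    rfl
  have transport : (sys.P₁ * sys.effortTransform m S ξ) *ᵥ (signMatrix 𝕜 n m *ᵥ ((HD ξ)⁻¹ *ᵥ u))
      = (HD ξ * S ξ)⁻¹ *ᵥ u := by
    rw [P₁_mul_effortTransform hP₁, Matrix.mulVec_mulVec, Matrix.mulVec_mulVec,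
      Matrix.mul_assoc (S ξ)⁻¹, signMatrix_mul_self, Matrix.mul_one, Matrix.mul_inv_rev]
  rw [split, Matrix.mulVec_sub, Matrix.mulVec_smul, transport, Matrix.mulVec_add,
    Matrix.mulVec_mulVec, Matrix.mulVec_mulVec]
  abel

lemma exists_eLpNorm_le_mul_eLpNorm_inv_mulVec : ∃ C : NNReal, ∀ w : ℝ → Fin n → 𝕜,
    eLpNorm w 2 (volume.restrict (Icc sys.a sys.b)) ≤
      C * eLpNorm (fun ξ => (HD ξ * S ξ)⁻¹ *ᵥ w ξ) 2 (volume.restrict (Icc sys.a sys.b)) := by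
  obtain ⟨C, hC⟩ := exists_eLpNorm_mulVec_le (p := 2) (memLp_Icc_apply_of_continuousOn
    (continuousOn_of_contDiffOn_apply hdiag.contDiffOn_HD_mul_S_apply) ⊤)
  refine ⟨C, fun w => (eLpNorm_congr_ae ?_).trans_le (hC _)⟩
  filter_upwards [ae_restrict_mem measurableSet_Icc] with ξ hξ
  rw [Matrix.mulVec_mulVec, Matrix.mul_nonsing_inv _
    ((Matrix.isUnit_iff_isUnit_det _).mp (hdiag.isUnit_HD_mul_S hξ)), Matrix.one_mulVec]

lemma exists_eLpNorm_smul_inv_mulVec_sub_le (hP₁ : IsUnit sys.P₁)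
    (hP₀ : ∀ i j, MemLp (fun ξ => sys.P₀ ξ i j) ⊤ (volume.restrict (Icc sys.a sys.b)))
    {G' : ℝ → Matrix (Fin n) (Fin n) 𝕜} (hG' : ContinuousOn G' (Icc sys.a sys.b)) :
    ∃ C : NNReal, ∀ (r : ℝ) (w w' : ℝ → Fin n → 𝕜),
      ContinuousOn w (Icc sys.a sys.b) → ContinuousOn w' (Icc sys.a sys.b) →
      eLpNorm (fun ξ => r • (HD ξ * S ξ)⁻¹ *ᵥ w ξ
          - (sys.P₁ *ᵥ (G' ξ *ᵥ w ξ + sys.effortTransform m S ξ *ᵥ w' ξ)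
            + sys.P₀ ξ *ᵥ (sys.effortTransform m S ξ *ᵥ w ξ)))
          2 (volume.restrict (Icc sys.a sys.b)) ≤
        C * (eLpNorm (fun ξ i => r • slowness m HD i ξ • w ξ i - w' ξ i)
            2 (volume.restrict (Icc sys.a sys.b))
          + eLpNorm w 2 (volume.restrict (Icc sys.a sys.b))) := by
  set μ := volume.restrict (Icc sys.a sys.b)
  have hG := continuousOn_of_contDiffOn_apply hdiag.contDiffOn_effortTransform_apply
  have P₁G_memLp := memLp_Icc_apply_of_continuousOn (continuousOn_const (c := sys.P₁).mul hG) ⊤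
  have P₁G'_memLp := memLp_Icc_apply_of_continuousOn (continuousOn_const (c := sys.P₁).mul hG') ⊤
  have G_memLp := memLp_Icc_apply_of_continuousOn hG ⊤
  obtain ⟨C₁, hC₁⟩ := exists_eLpNorm_mulVec_le (p := 2) P₁G_memLp
  obtain ⟨C₂, hC₂⟩ := exists_eLpNorm_mulVec_le (p := 2) P₁G'_memLp
  obtain ⟨C₃, hC₃⟩ := exists_eLpNorm_mulVec_le (p := 2) hP₀
  obtain ⟨C₄, hC₄⟩ := exists_eLpNorm_mulVec_le (p := 2) G_memLp
  refine ⟨C₁ + (C₂ + C₃ * C₄), fun r w w' hw hw' => ?_⟩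
  set defect : ℝ → Fin n → 𝕜 := fun ξ i => r • slowness m HD i ξ • w ξ i - w' ξ i
  have defect_memLp : MemLp defect 2 μ :=
    memLp_Icc_of_continuousOn (continuousOn_pi.mpr fun i => (((hdiag.continuousOn_slowness i).smul
      (continuousOn_pi.mp hw i)).const_smul r).sub (continuousOn_pi.mp hw' i)) 2
  have w_memLp : MemLp w 2 μ := memLp_Icc_of_continuousOn hw 2
  have Gw_memLp := memLp_mulVec G_memLp w_memLp
  calc _ = eLpNorm ((fun ξ => (sys.P₁ * sys.effortTransform m S ξ) *ᵥ defect ξ)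
          - ((fun ξ => (sys.P₁ * G' ξ) *ᵥ w ξ)
            + fun ξ => sys.P₀ ξ *ᵥ (sys.effortTransform m S ξ *ᵥ w ξ))) 2 μ := by
        refine eLpNorm_congr_ae ?_
        filter_upwards [ae_restrict_mem measurableSet_Icc] with ξ hξ
        simp only [Pi.sub_apply, Pi.add_apply]
        rw [← sub_sub, hdiag.smul_inv_mulVec_sub_eq hP₁ hξ, sub_sub]
    _ ≤ C₁ * eLpNorm defect 2 μ + (C₂ * eLpNorm w 2 μ + C₃ * (C₄ * eLpNorm w 2 μ)) := by
        refine (eLpNorm_sub_le (memLp_mulVec P₁G_memLp defect_memLp).1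
          ((memLp_mulVec P₁G'_memLp w_memLp).1.add (memLp_mulVec hP₀ Gw_memLp).1)
          one_le_two).trans (add_le_add (hC₁ _) ?_)
        refine (eLpNorm_add_le (memLp_mulVec P₁G'_memLp w_memLp).1 (memLp_mulVec hP₀ Gw_memLp).1
          one_le_two).trans (add_le_add (hC₂ _) ((hC₃ _).trans ?_))
        gcongr
        exact hC₄ w
    _ ≤ (C₁ + (C₂ + C₃ * C₄) : NNReal) * (eLpNorm defect 2 μ + eLpNorm w 2 μ) := by
        push_cast
        rw [← mul_assoc, ← add_mul, mul_add]
        gcongr ?_ * _ + ?_ * _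
        exacts [le_self_add, le_add_self]

lemma exists_hasH1Deriv_effortTransform (hab : sys.a < sys.b) (hP₁ : IsUnit sys.P₁)
    (hP₀ : ∀ i j, MemLp (fun ξ => sys.P₀ ξ i j) ⊤ (volume.restrict (Icc sys.a sys.b))) :
    ∃ C : NNReal, ∀ (r : ℝ) (w w' : ℝ → Fin n → 𝕜),
      (∀ ξ ∈ Icc sys.a sys.b, HasDerivWithinAt w (w' ξ) (Icc sys.a sys.b) ξ) →
      ContinuousOn w' (Icc sys.a sys.b) →
      ∃ v', HasH1Deriv sys.a sys.b (fun ξ => sys.effortTransform m S ξ *ᵥ w ξ) v' ∧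
        eLpNorm (fun ξ => r • (HD ξ * S ξ)⁻¹ *ᵥ w ξ
            - (sys.P₁ *ᵥ v' ξ + sys.P₀ ξ *ᵥ (sys.effortTransform m S ξ *ᵥ w ξ)))
            2 (volume.restrict (Icc sys.a sys.b)) ≤
          C * (eLpNorm (fun ξ i => r • slowness m HD i ξ • w ξ i - w' ξ i)
              2 (volume.restrict (Icc sys.a sys.b))
            + eLpNorm w 2 (volume.restrict (Icc sys.a sys.b))) := by
  obtain ⟨G', G'_continuousOn, hG'⟩ :=
    exists_hasDerivWithinAt_of_contDiffOn_apply hab hdiag.contDiffOn_effortTransform_apply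
  have G_continuousOn := continuousOn_of_contDiffOn_apply hdiag.contDiffOn_effortTransform_apply
  obtain ⟨C, hC⟩ := hdiag.exists_eLpNorm_smul_inv_mulVec_sub_le hP₁ hP₀ G'_continuousOn
  refine ⟨C, fun r w w' hw hw' => ?_⟩
  have hw_cont : ContinuousOn w (Icc sys.a sys.b) := fun ξ hξ => (hw ξ hξ).continuousWithinAt
  exact ⟨fun ξ => G' ξ *ᵥ w ξ + sys.effortTransform m S ξ *ᵥ w' ξ,
    .of_hasDerivWithinAt (fun ξ hξ => hasDerivWithinAt_mulVec (hG' ξ hξ) (hw ξ hξ))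
      (memLp_Icc_of_continuousOn ((continuousOn_mulVec G'_continuousOn hw_cont).add
        (continuousOn_mulVec G_continuousOn hw')) 2),
    hC r w w' hw_cont hw'⟩

lemma exists_operator_eLpNorm_le (hab : sys.a < sys.b) (hP₁ : IsUnit sys.P₁)
    (hP₀ : ∀ i j, MemLp (fun ξ => sys.P₀ ξ i j) ⊤ (volume.restrict (Icc sys.a sys.b))) :
    ∃ C : NNReal, ∀ (r : ℝ) (w w' : ℝ → Fin n → 𝕜),
      (∀ ξ ∈ Icc sys.a sys.b, HasDerivWithinAt w (w' ξ) (Icc sys.a sys.b) ξ) →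
      ContinuousOn w' (Icc sys.a sys.b) →
      (sys.diagonalise m S HD).WB *ᵥ Sum.elim (w sys.b) (w sys.a) = 0 →
      ∃ x y : sys.StateSpace, sys.operator x y ∧
        (fun ξ => (x ξ).ofLp) =ᵐ[volume.restrict (Icc sys.a sys.b)]
          (fun ξ => (HD ξ * S ξ)⁻¹ *ᵥ w ξ) ∧
        eLpNorm (fun ξ => (((r : 𝕜) • x - y) ξ).ofLp) 2 (volume.restrict (Icc sys.a sys.b)) ≤
          C * (eLpNorm (fun ξ i => r • slowness m HD i ξ • w ξ i - w' ξ i)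
              2 (volume.restrict (Icc sys.a sys.b))
            + eLpNorm w 2 (volume.restrict (Icc sys.a sys.b))) := by
  obtain ⟨C, hC⟩ := hdiag.exists_hasH1Deriv_effortTransform hab hP₁ hP₀
  refine ⟨C, fun r w w' hw hw' hWB => ?_⟩
  obtain ⟨v', hv', norm_le⟩ := hC r w w' hw hw'
  have w_memLp : MemLp w 2 (volume.restrict (Icc sys.a sys.b)) :=
    memLp_Icc_of_continuousOn (fun ξ hξ => (hw ξ hξ).continuousWithinAt) 2
  have inv_memLp := memLp_Icc_apply_of_continuousOn
    (continuousOn_of_contDiffOn_apply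
      (contDiffOn_inv_apply hdiag.contDiffOn_HD_mul_S_apply fun _ => hdiag.isUnit_HD_mul_S)) ⊤
  have effort_memLp := memLp_mulVec (memLp_Icc_apply_of_continuousOn
    (continuousOn_of_contDiffOn_apply hdiag.contDiffOn_effortTransform_apply) ⊤) w_memLp
  obtain ⟨x, hx⟩ := exists_ofLp_ae_eq 2 (memLp_mulVec inv_memLp w_memLp)
  obtain ⟨y, hy⟩ := exists_ofLp_ae_eq 2
    ((memLp_mulVec (fun i j => memLp_top_const (sys.P₁ i j)) hv'.1).add
      (memLp_mulVec hP₀ effort_memLp))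
  refine ⟨x, y, ⟨_, v', hv', ?_, ?_, hy⟩, hx, (eLpNorm_congr_ae ?_).trans_le norm_le⟩
  · filter_upwards [hx, hdiag.H_mul_inv_eq_effortTransform hP₁] with ξ hxξ hH
    rw [hxξ, Matrix.mulVec_mulVec, hH]
  · rwa [← diagonalise_WB_mulVec]
  · filter_upwards [hx, hy, Lp.coeFn_sub ((r : 𝕜) • x) y, Lp.coeFn_smul (r : 𝕜) x]
      with ξ hxξ hyξ hsub hsmul
    rw [hsub, Pi.sub_apply, hsmul, Pi.smul_apply, WithLp.ofLp_sub, WithLp.ofLp_smul, hxξ, hyξ,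
      RCLike.real_smul_eq_coe_smul (K := 𝕜)]
    rfl

lemma exists_incoming_waves (hab : sys.a < sys.b) {k : Fin n → 𝕜} (hk : k ≠ 0) :
    ∃ C : NNReal, ∀ r : ℝ, 0 < r → ∃ w w' : ℝ → Fin n → 𝕜,
      (∀ ξ ∈ Icc sys.a sys.b, HasDerivWithinAt w (w' ξ) (Icc sys.a sys.b) ξ) ∧
      ContinuousOn w' (Icc sys.a sys.b) ∧
      w sys.b = projPos (signMatrix 𝕜 n m) *ᵥ k ∧ w sys.a = projNeg (signMatrix 𝕜 n m) *ᵥ k ∧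
      eLpNorm w 2 (volume.restrict (Icc sys.a sys.b)) ≠ 0 ∧
      eLpNorm (fun ξ i => r • slowness m HD i ξ • w ξ i - w' ξ i)
          2 (volume.restrict (Icc sys.a sys.b)) ≤
        C * eLpNorm w 2 (volume.restrict (Icc sys.a sys.b)) := by
  choose s hs using hdiag.exists_isTravelTime hab
  obtain ⟨C, hC⟩ := exists_travelling_waves hab one_le_two hdiag.continuousOn_slowness hs k
  refine ⟨C, fun r hr => ?_⟩
  obtain ⟨w, w', hw, hw', w_inlet, w_outlet, defect_le⟩ := hC r hr
  refine ⟨w, w', hw, hw', ?_, ?_, ?_, defect_le⟩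
  · rw [projPos_signMatrix_mulVec]
    ext i
    specialize w_inlet i
    specialize w_outlet i
    split_ifs at * <;> assumption
  · rw [projNeg_signMatrix_mulVec]
    ext i
    specialize w_inlet i
    specialize w_outlet i
    split_ifs at * <;> assumption
  · obtain ⟨i, hi⟩ := Function.ne_iff.mp hk
    exact eLpNorm_Icc_ne_zero_of_continuousOn hab (fun ξ hξ => (hw ξ hξ).continuousWithinAt)
      two_ne_zero (hs i).inlet_mem (Function.ne_iff.mpr ⟨i, (w_inlet i).trans_ne hi⟩)

lemma exists_approximate_eigenvectors (hab : sys.a < sys.b) (hP₁ : IsUnit sys.P₁)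
    (hP₀ : ∀ i j, MemLp (fun ξ => sys.P₀ ξ i j) ⊤ (volume.restrict (Icc sys.a sys.b)))
    {k : Fin n → 𝕜} (hk : k ≠ 0)
    (hWB : (sys.diagonalise m S HD).WB *ᵥ Sum.elim (projPos (signMatrix 𝕜 n m) *ᵥ k)
      (projNeg (signMatrix 𝕜 n m) *ᵥ k) = 0) :
    ∃ C : ℝ, ∀ r : ℝ, 0 < r → ∃ x y : sys.StateSpace,
      sys.operator x y ∧ x ≠ 0 ∧ ‖(r : 𝕜) • x - y‖ ≤ C * ‖x‖ := by
  set μ := volume.restrict (Icc sys.a sys.b)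
  obtain ⟨C₁, hC₁⟩ := hdiag.exists_incoming_waves hab hk
  obtain ⟨C₂, hC₂⟩ := hdiag.exists_operator_eLpNorm_le hab hP₁ hP₀
  obtain ⟨C₃, hC₃⟩ := hdiag.exists_eLpNorm_le_mul_eLpNorm_inv_mulVec
  refine ⟨(Fintype.card (Fin n) : NNReal) ^ (1 / 2 : ENNReal).toReal
    * (C₂ * ((C₁ + 1) * C₃) : NNReal), fun r hr => ?_⟩
  obtain ⟨w, w', hw, hw', w_b, w_a, w_ne_zero, defect_le⟩ := hC₁ r hr
  obtain ⟨x, y, hxy, hx, norm_le⟩ := hC₂ r w w' hw hw' (by rw [w_b, w_a, hWB])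
  have w_le : eLpNorm w 2 μ ≤ C₃ * eLpNorm (fun ξ => (x ξ).ofLp) 2 μ :=
    (hC₃ w).trans_eq (by rw [eLpNorm_congr_ae hx])
  refine ⟨x, y, hxy, ?_, norm_le_mul_norm_of_eLpNorm_ofLp_le ?_⟩
  · rintro rfl
    have ofLp_eq_zero : eLpNorm (fun ξ => ((0 : sys.StateSpace) ξ).ofLp) 2 μ = 0 :=
      (eLpNorm_congr_ae ((Lp.coeFn_zero ..).fun_comp WithLp.ofLp)).trans eLpNorm_zero
    rw [ofLp_eq_zero, mul_zero] at w_le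
    exact w_ne_zero (nonpos_iff_eq_zero.mp w_le)
  · calc _ ≤ C₂ * (eLpNorm (fun ξ i => r • slowness m HD i ξ • w ξ i - w' ξ i) 2 μ
          + eLpNorm w 2 μ) := norm_le
      _ ≤ C₂ * (C₁ * eLpNorm w 2 μ + eLpNorm w 2 μ) := by gcongr
      _ = C₂ * ((C₁ + 1) * eLpNorm w 2 μ) := by rw [add_one_mul]
      _ ≤ C₂ * ((C₁ + 1) * (C₃ * eLpNorm (fun ξ => (x ξ).ofLp) 2 μ)) := by gcongr
      _ = _ := by push_cast; ring

end IsC1Diagonalisation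

theorem isUnit_diagonalise_WB_mul_fromRows (hab : sys.a < sys.b) (hP₁ : IsUnit sys.P₁)
    (hP₀ : ∀ i j, MemLp (fun ξ => sys.P₀ ξ i j) ⊤ (volume.restrict (Icc sys.a sys.b)))
    (hgen : GeneratesC0Semigroup 𝕜 sys.operator) (hdiag : sys.IsC1Diagonalisation m S HD) :
    IsUnit ((sys.diagonalise m S HD).WB *
      Matrix.fromRows (projPos (signMatrix 𝕜 n m)) (projNeg (signMatrix 𝕜 n m))) := by
  rw [Matrix.isUnit_iff_isUnit_det, isUnit_iff_ne_zero]
  intro det_eq_zero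
  obtain ⟨k, hk, mulVec_eq_zero⟩ := Matrix.exists_mulVec_eq_zero_iff.mpr det_eq_zero
  rw [← Matrix.mulVec_mulVec, Matrix.fromRows_mulVec] at mulVec_eq_zero
  obtain ⟨C, hC⟩ := hdiag.exists_approximate_eigenvectors hab hP₁ hP₀ hk mulVec_eq_zero
  obtain ⟨R, hR⟩ := hgen.bddAbove_approximate_eigenvalues C
  have := hR (hC (max R 0 + 1) (by positivity))
  linarith [le_max_left R 0]

end HBCS

theorem mainTheorem5_general (sys : HBCS 𝕜 n) (hab : sys.a < sys.b) (hP₁ : IsUnit sys.P₁)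
    (hP₀ : ∀ i j, MemLp (fun ξ => sys.P₀ ξ i j) ⊤ (volume.restrict (Icc sys.a sys.b)))
    (hgen : GeneratesC0Semigroup 𝕜 sys.operator) (m : ℕ)
    (S HD : ℝ → Matrix (Fin n) (Fin n) 𝕜) (hdiag : sys.IsC1Diagonalisation m S HD) :
    IsUnit ((sys.diagonalise m S HD).WB *
      Matrix.fromRows (projPos (sys.diagonalise m S HD).P₁)
        (projNeg (sys.diagonalise m S HD).P₁)) ∧
    ∃ K M : Matrix (Fin n) (Fin n) 𝕜, IsUnit K ∧
      (sys.diagonalise m S HD).WB =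
        K * Matrix.fromCols
          (rootPos (sys.diagonalise m S HD).P₁ - M * rootNeg (sys.diagonalise m S HD).P₁)
          (rootNeg (sys.diagonalise m S HD).P₁ - M * rootPos (sys.diagonalise m S HD).P₁) := by
  have hP := isHermitian_signMatrix (𝕜 := 𝕜) (n := n) m
  have hPP := signMatrix_mul_self (𝕜 := 𝕜) (n := n) m
  have isUnit := HBCS.isUnit_diagonalise_WB_mul_fromRows hab hP₁ hP₀ hgen hdiag
  refine ⟨isUnit, ?_⟩
  rw [projNeg_of_mul_self_eq_one hP hPP] at isUnit
  rw [show (sys.diagonalise m S HD).P₁ = signMatrix 𝕜 n m from rfl,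
    rootPos_of_mul_self_eq_one hP hPP, rootNeg_of_mul_self_eq_one hP hPP,
    projNeg_of_mul_self_eq_one hP hPP]
  exact exists_eq_mul_fromCols_of_isUnit (isStarProjection_projPos hP hPP).isIdempotentElem isUnit

end

theorem mainTheorem5 {𝕜 : Type*} [RCLike 𝕜] {n : ℕ} (sys : HBCS 𝕜 n)
    (hsys : sys.StandingAssumption) (m : ℕ) (S HD : ℝ → Matrix (Fin n) (Fin n) 𝕜)
    (hdiag : sys.IsC1Diagonalisation m S HD) :
    IsUnit ((sys.diagonalise m S HD).WB *
      Matrix.fromRows (projPos (sys.diagonalise m S HD).P₁)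
        (projNeg (sys.diagonalise m S HD).P₁)) ∧
    ∃ K M : Matrix (Fin n) (Fin n) 𝕜, IsUnit K ∧
      (sys.diagonalise m S HD).WB =
        K * Matrix.fromCols
          (rootPos (sys.diagonalise m S HD).P₁ - M * rootNeg (sys.diagonalise m S HD).P₁)
          (rootNeg (sys.diagonalise m S HD).P₁ - M * rootPos (sys.diagonalise m S HD).P₁) :=
  mainTheorem5_general sys hsys.a_lt_b hsys.P₁_isUnit hsys.P₀_memLp hsys.generates m S HD hdiag
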